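/- For a permutation $\pi=a_1,a_2,\ldots,a_n$ of $\{1,2,\ldots,n\}$ (so $a_i=\pi(i)$), call $a_i$ a left-to-right maximum if $a_j<a_i$ for all $1\le j<i$, and count fixed points as cycles of length one. Let $\mathcal S_n$ be the set of all permutations of $\{1,2,\ldots,n\}$. For all non-negative integers $n,p,q$, the number of permutations in $\mathcal S_n$ with exactly $p$ cycles and exactly $q$ left-to-right maxima equals the number of permutations in $\mathcal S_n$ with exactly $q$ cycles and exactly $p$ left-to-right maxima. -/

import Mathlib

/-- The number of cycles of a permutation of `{1, …, n}`, modelled on `Fin n`: the number of classes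
of the relation "`i` and `j` lie on the same cycle". Fixed points count as cycles of length one. -/
noncomputable def numCycles {n : ℕ} (π : Equiv.Perm (Fin n)) : ℕ :=
  Nat.card (Quotient (Equiv.Perm.SameCycle.setoid π))

/-- The number of left-to-right maxima of the sequence `π 0, π 1, …, π (n - 1)`: the number of
positions `i` such that `π j < π i` for every earlier position `j`. -/
def numLeftToRightMaxima {n : ℕ} (π : Equiv.Perm (Fin n)) : ℕ :=
  (Finset.univ.filter fun i : Fin n => ∀ j : Fin n, j < i → π j < π i).card

open Equiv

/-! Conjugation by `Fin.revPerm` exchanges left-to-right maxima and right-to-left minima, so it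
suffices to find a bijection `Φ` turning cycles into right-to-left minima while preserving
left-to-right maxima; then `Φ⁻¹ ∘ conj ∘ Φ` exchanges the two statistics. `Φ` is built by recursion
from two codings of a permutation by a pair `(p, e)`: `decomposeFin`, which gains a cycle exactly
when `p = 0`, and `lehmerInsert`, which gains a right-to-left minimum exactly when `p = 0`. Both
change the left-to-right maxima by the same rule. That rule discards values up to `p`, so the
induction must carry the set of values, not just its size. -/

theorem Equiv.Perm.SameCycle.apply_eq_of_invariant {α β : Type*} {σ : Perm α} {f : α → β}
    (hf : ∀ x, f (σ x) = f x) {x y : α} (h : σ.SameCycle x y) : f x = f y := by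
  obtain ⟨k, rfl⟩ := h
  have hinv : ∀ x, f (σ⁻¹ x) = f x := fun x => by
    rw [← hf (σ⁻¹ x), ← Perm.mul_apply, mul_inv_cancel, Perm.one_apply]
  induction k with
  | zero => simp
  | succ k ih => rw [add_comm, zpow_add, Perm.mul_apply, zpow_one, hf]; exact ih
  | pred k ih => rw [sub_eq_neg_add, zpow_add, Perm.mul_apply, zpow_neg_one, hinv]; exact ih

/-- Each step of `e` survives, except that the step into `p` detours through `0`. -/
theorem Equiv.Perm.sameCycle_decomposeFin_symm_succ {n : ℕ} (p : Fin (n + 1)) (e : Perm (Fin n))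
    (i : Fin n) : (Perm.decomposeFin.symm (p, e)).SameCycle i.succ (e i).succ := by
  set σ := Perm.decomposeFin.symm (p, e) with hσ
  by_cases h : (e i).succ = p
  · have h1 : σ i.succ = 0 := by simp [hσ, h]
    have h2 : σ 0 = (e i).succ := by simp [hσ, h]
    rw [← h2, ← h1]
    exact (Perm.sameCycle_apply_right.2 (Perm.sameCycle_apply_right.2 (Perm.SameCycle.refl _ _)))
  · have h1 : σ i.succ = (e i).succ := by
      rw [hσ, Perm.decomposeFin_symm_apply_succ, swap_apply_of_ne_of_ne (Fin.succ_ne_zero _) h]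
    rw [← h1]
    exact Perm.sameCycle_apply_right.2 (Perm.SameCycle.refl _ _)

/-- The map on cycles induced by inserting `0` into the cycles of `e`, right before `p`. -/
def cycleQuotientSucc {n : ℕ} (p : Fin (n + 1)) (e : Perm (Fin n)) :
    Quotient (Perm.SameCycle.setoid e) →
      Quotient (Perm.SameCycle.setoid (Perm.decomposeFin.symm (p, e))) :=
  Quotient.lift (fun i => Quotient.mk _ i.succ) fun _ _ h =>
    Perm.SameCycle.apply_eq_of_invariant
      (f := fun i => Quotient.mk (Perm.SameCycle.setoid (Perm.decomposeFin.symm (p, e))) i.succ)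
      (fun i => (Quotient.sound (Perm.sameCycle_decomposeFin_symm_succ p e i)).symm) h

theorem numCycles_decomposeFin_symm_zero {n : ℕ} (e : Perm (Fin n)) :
    numCycles (Perm.decomposeFin.symm (0, e)) = numCycles e + 1 := by
  unfold numCycles
  rw [← Finite.card_option]
  let r : Fin (n + 1) → Option (Quotient (Perm.SameCycle.setoid e)) :=
    Fin.cases none fun i => some (Quotient.mk _ i)
  have hr : ∀ x, r (Perm.decomposeFin.symm (0, e) x) = r x := by
    refine Fin.cases (by simp) fun i => ?_
    simp only [Perm.decomposeFin_symm_apply_succ, swap_self, refl_apply, r, Fin.cases_succ]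
    exact congrArg some (Quotient.sound (Perm.sameCycle_apply_left.2 (Perm.SameCycle.refl _ _)))
  refine Nat.card_congr
    { toFun := Quotient.lift r fun _ _ h => Perm.SameCycle.apply_eq_of_invariant hr h
      invFun := fun o => o.elim (Quotient.mk _ 0) (cycleQuotientSucc 0 e)
      left_inv := ?_
      right_inv := ?_ }
  · intro x
    induction x using Quotient.inductionOn with
    | h x => cases x using Fin.cases <;> rfl
  · rintro (_ | x)
    · rfl
    · induction x using Quotient.inductionOn with
      | h x => rfl

theorem numCycles_decomposeFin_symm_succ {n : ℕ} (a : Fin n) (e : Perm (Fin n)) :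
    numCycles (Perm.decomposeFin.symm (a.succ, e)) = numCycles e := by
  unfold numCycles
  -- The inserted `0` joins the cycle of `a`, so no new class appears.
  let r : Fin (n + 1) → Quotient (Perm.SameCycle.setoid e) :=
    Fin.cases (Quotient.mk _ a) fun i => Quotient.mk _ i
  have hr : ∀ x, r (Perm.decomposeFin.symm (a.succ, e) x) = r x := by
    refine Fin.cases (by simp [r]) fun i => ?_
    have h : Quotient.mk (Perm.SameCycle.setoid e) (e i) = Quotient.mk _ i :=
      Quotient.sound (Perm.sameCycle_apply_left.2 (Perm.SameCycle.refl _ _))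
    rw [Perm.decomposeFin_symm_apply_succ]
    by_cases hi : e i = a
    · simpa [r, hi] using h
    · rw [swap_apply_of_ne_of_ne (Fin.succ_ne_zero _) (by simpa using hi)]
      exact h
  refine Nat.card_congr
    { toFun := Quotient.lift r fun _ _ h => Perm.SameCycle.apply_eq_of_invariant hr h
      invFun := cycleQuotientSucc a.succ e
      left_inv := ?_
      right_inv := ?_ }
  · intro x
    induction x using Quotient.inductionOn with
    | h x =>
      cases x using Fin.cases with
      | succ i => rfl
      | zero =>
        refine Quotient.sound (s := Perm.SameCycle.setoid _) ?_
        change Perm.SameCycle _ a.succ 0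
        have h : Perm.decomposeFin.symm (a.succ, e) 0 = a.succ := by simp
        conv_lhs => rw [← h]
        exact Perm.sameCycle_apply_left.2 (Perm.SameCycle.refl _ _)
  · intro x
    induction x using Quotient.inductionOn with
    | h x => rfl

/-- The set of values of the left-to-right maxima of `π`. -/
def leftToRightMaxima {n : ℕ} (π : Perm (Fin n)) : Finset (Fin n) :=
  (Finset.univ.filter fun i : Fin n => ∀ j : Fin n, j < i → π j < π i).map π.toEmbedding

/-- The number of right-to-left minima of `π`. -/
def numRightToLeftMinima {n : ℕ} (π : Perm (Fin n)) : ℕ :=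
  (Finset.univ.filter fun i : Fin n => ∀ j : Fin n, i < j → π i < π j).card

theorem card_leftToRightMaxima {n : ℕ} (π : Perm (Fin n)) :
    (leftToRightMaxima π).card = numLeftToRightMaxima π :=
  Finset.card_map _

theorem mem_leftToRightMaxima {n : ℕ} {π : Perm (Fin n)} {y : Fin n} :
    y ∈ leftToRightMaxima π ↔ ∃ i, (∀ j, j < i → π j < π i) ∧ π i = y := by
  simp only [leftToRightMaxima, Finset.mem_map, Finset.mem_filter_univ, coe_toEmbedding]

/-- The leading value `τ 0` blocks every smaller value from being a record, and `τ` does not move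
the larger ones. How `τ` permutes the small values is irrelevant, so both `swap 0 p` and
`p.cycleRange.symm` qualify. -/
theorem leftToRightMaxima_mul_decomposeFin_symm_zero {n : ℕ} {τ : Perm (Fin (n + 1))}
    (hτ : ∀ y, τ 0 < y → τ y = y) (e : Perm (Fin n)) :
    leftToRightMaxima (τ * Perm.decomposeFin.symm (0, e)) =
      insert (τ 0) (((leftToRightMaxima e).map (Fin.succEmb n)).filter (τ 0 < ·)) := by
  have hfix : ∀ {y}, τ 0 < τ y → τ 0 < y := fun {y} h => by
    rwa [τ.injective (hτ _ h)] at h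
  have key : ∀ i : Fin n, (τ 0 < τ (e i).succ ∧ ∀ j < i, τ (e j).succ < τ (e i).succ) ↔
      τ 0 < (e i).succ ∧ ∀ j < i, e j < e i := by
    intro i
    constructor
    · rintro ⟨h0, h⟩
      have h0' := hfix h0
      refine ⟨h0', fun j hj => ?_⟩
      have := h j hj
      rw [hτ _ h0'] at this
      by_cases hp : τ 0 < (e j).succ
      · rwa [hτ _ hp, Fin.succ_lt_succ_iff] at this
      · exact Fin.succ_lt_succ_iff.1 ((not_lt.1 hp).trans_lt h0')
    · rintro ⟨h0, h⟩
      rw [hτ _ h0]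
      refine ⟨h0, fun j hj => ?_⟩
      by_cases hp : τ 0 < (e j).succ
      · rw [hτ _ hp]
        exact Fin.succ_lt_succ_iff.2 (h j hj)
      · exact (not_lt.1 fun h' => hp (hfix h')).trans_lt h0
  ext y
  simp only [mem_leftToRightMaxima, Fin.exists_fin_succ, Fin.forall_fin_succ, Perm.mul_apply,
    Perm.decomposeFin_symm_apply_zero, Perm.decomposeFin_symm_apply_succ, swap_self, refl_apply,
    Fin.succ_lt_succ_iff, Fin.succ_pos, forall_true_left, key, Finset.mem_insert,
    Finset.mem_filter, Finset.mem_map, Fin.coe_succEmb]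
  constructor
  · rintro (⟨-, rfl⟩ | ⟨i, ⟨h0, h⟩, rfl⟩)
    · exact Or.inl rfl
    · rw [hτ _ h0]
      exact Or.inr ⟨⟨e i, ⟨i, h, rfl⟩, rfl⟩, h0⟩
  · rintro (rfl | ⟨⟨z, ⟨i, h, rfl⟩, rfl⟩, h0⟩)
    · exact Or.inl ⟨by simp, rfl⟩
    · exact Or.inr ⟨i, ⟨h0, h⟩, hτ _ h0⟩

theorem Equiv.Perm.decomposeFin_symm_eq_swap_mul {n : ℕ} (p : Fin (n + 1)) (e : Perm (Fin n)) :
    Perm.decomposeFin.symm (p, e) = swap 0 p * Perm.decomposeFin.symm (0, e) := by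
  ext x
  cases x using Fin.cases <;> simp

/-- The Lehmer coding: the permutation with first value `p` whose other values are ordered as
those of `e`. -/
def lehmerInsert {n : ℕ} (x : Fin (n + 1) × Perm (Fin n)) : Perm (Fin (n + 1)) :=
  x.1.cycleRange.symm * Perm.decomposeFin.symm (0, x.2)

theorem lehmerInsert_zero {n : ℕ} (x : Fin (n + 1) × Perm (Fin n)) : lehmerInsert x 0 = x.1 := by
  simp [lehmerInsert]

theorem lehmerInsert_succ {n : ℕ} (x : Fin (n + 1) × Perm (Fin n)) (i : Fin n) :
    lehmerInsert x i.succ = x.1.succAbove (x.2 i) := by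
  simp [lehmerInsert]

theorem lehmerInsert_bijective (n : ℕ) : Function.Bijective (lehmerInsert (n := n)) := by
  rw [Fintype.bijective_iff_injective_and_card]
  refine ⟨fun x y h => ?_, Fintype.card_congr Perm.decomposeFin.symm⟩
  have h1 : x.1 = y.1 := by rw [← lehmerInsert_zero x, h, lehmerInsert_zero]
  refine Prod.ext h1 ?_
  simp only [lehmerInsert, h1, mul_right_inj, EmbeddingLike.apply_eq_iff_eq, Prod.mk.injEq,
    true_and] at h
  exact h

theorem leftToRightMaxima_lehmerInsert {n : ℕ} (p : Fin (n + 1)) (e : Perm (Fin n)) :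
    leftToRightMaxima (lehmerInsert (p, e)) =
      insert p (((leftToRightMaxima e).map (Fin.succEmb n)).filter (p < ·)) := by
  have h0 : p.cycleRange.symm 0 = p := Fin.cycleRange_symm_zero p
  have := leftToRightMaxima_mul_decomposeFin_symm_zero (τ := p.cycleRange.symm)
    (fun y hy => by rw [h0] at hy; rw [symm_apply_eq, Fin.cycleRange_of_gt hy]) e
  rwa [h0] at this

theorem leftToRightMaxima_decomposeFin_symm {n : ℕ} (p : Fin (n + 1)) (e : Perm (Fin n)) :
    leftToRightMaxima (Perm.decomposeFin.symm (p, e)) =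
      insert p (((leftToRightMaxima e).map (Fin.succEmb n)).filter (p < ·)) := by
  have h0 : swap 0 p 0 = p := swap_apply_left 0 p
  have := leftToRightMaxima_mul_decomposeFin_symm_zero (τ := swap 0 p)
    (fun y hy => by
      rw [h0] at hy
      exact swap_apply_of_ne_of_ne ((Fin.zero_le p).trans_lt hy).ne' hy.ne') e
  rwa [h0, ← Perm.decomposeFin_symm_eq_swap_mul] at this

theorem numRightToLeftMinima_lehmerInsert {n : ℕ} (p : Fin (n + 1)) (e : Perm (Fin n)) :
    numRightToLeftMinima (lehmerInsert (p, e)) =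
      numRightToLeftMinima e + if p = 0 then 1 else 0 := by
  have h0 : (∀ j : Fin n, p < p.succAbove (e j)) ↔ p = 0 := by
    constructor
    -- If `p ≠ 0`, the value `0` occurs later and undercuts `p`.
    · intro h
      by_contra hp
      obtain ⟨z, hz⟩ := Fin.exists_succAbove_eq (Ne.symm hp)
      have := h (e.symm z)
      rw [apply_symm_apply, hz] at this
      exact absurd this (Fin.not_lt_zero _)
    · rintro rfl j
      simp
  simp only [numRightToLeftMinima, Fin.card_filter_univ_succ, Fin.forall_fin_succ,
    lehmerInsert_zero, lehmerInsert_succ, false_imp_iff, true_and,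
    Fin.succ_pos, forall_true_left, Fin.not_lt_zero, Fin.succ_lt_succ_iff,
    Fin.succAbove_lt_succAbove_iff, h0]
  split_ifs <;> simp

/-- There is a bijection taking the number of cycles to the number of right-to-left minima and
keeping the values of the left-to-right maxima. -/
theorem exists_equiv_numCycles_eq_numRightToLeftMinima (n : ℕ) :
    ∃ Φ : Perm (Fin n) ≃ Perm (Fin n), ∀ π, numRightToLeftMinima (Φ π) = numCycles π ∧
      leftToRightMaxima (Φ π) = leftToRightMaxima π := by
  induction n with
  | zero =>
    refine ⟨Equiv.refl _, fun π => ⟨?_, rfl⟩⟩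
    have : IsEmpty (Quotient (Perm.SameCycle.setoid π)) := ⟨fun x => x.inductionOn finZeroElim⟩
    simp [numCycles, numRightToLeftMinima]
  | succ n ih =>
    obtain ⟨Φ, hΦ⟩ := ih
    refine ⟨(Perm.decomposeFin.trans ((Equiv.refl _).prodCongr Φ)).trans
      (Equiv.ofBijective _ (lehmerInsert_bijective n)), fun π => ?_⟩
    obtain ⟨⟨p, e⟩, rfl⟩ := Perm.decomposeFin.symm.surjective π
    simp only [trans_apply, apply_symm_apply, prodCongr_apply, Prod.map_apply, refl_apply,
      ofBijective_apply, numRightToLeftMinima_lehmerInsert, leftToRightMaxima_lehmerInsert,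
      leftToRightMaxima_decomposeFin_symm, (hΦ e).1, (hΦ e).2, and_true]
    cases p using Fin.cases with
    | zero => simp [numCycles_decomposeFin_symm_zero]
    | succ a => simp [numCycles_decomposeFin_symm_succ]

/-- Conjugation by `rev` reverses both positions and values. -/
theorem numLeftToRightMaxima_conj_rev {n : ℕ} (π : Perm (Fin n)) :
    numLeftToRightMaxima (Fin.revPerm.permCongr π) = numRightToLeftMinima π := by
  refine Finset.card_equiv Fin.revPerm fun i => ?_
  simp only [Finset.mem_filter_univ, permCongr_apply, Fin.revPerm_symm, Fin.revPerm_apply,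
    Fin.rev_lt_rev]
  exact (Fin.revPerm.forall_congr fun j => by simp [Fin.rev_lt_rev])

theorem numRightToLeftMinima_conj_rev {n : ℕ} (π : Perm (Fin n)) :
    numRightToLeftMinima (Fin.revPerm.permCongr π) = numLeftToRightMaxima π := by
  rw [← numLeftToRightMaxima_conj_rev]
  congr 1
  ext
  simp

theorem theorem2 (n p q : ℕ) :
    Nat.card {π : Equiv.Perm (Fin n) // numCycles π = p ∧ numLeftToRightMaxima π = q} =
      Nat.card {π : Equiv.Perm (Fin n) // numCycles π = q ∧ numLeftToRightMaxima π = p} := by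
  obtain ⟨Φ, hΦ⟩ := exists_equiv_numCycles_eq_numRightToLeftMinima n
  have hmax : ∀ π, numLeftToRightMaxima (Φ π) = numLeftToRightMaxima π := fun π => by
    rw [← card_leftToRightMaxima, (hΦ π).2, card_leftToRightMaxima]
  refine Nat.card_congr
    (((Φ.trans Fin.revPerm.permCongr).trans Φ.symm).subtypeEquiv fun π => ?_)
  -- Reading both statistics after applying `Φ` cancels the outer `Φ.symm`.
  rw [← (hΦ (((Φ.trans Fin.revPerm.permCongr).trans Φ.symm) π)).1, ← hmax (((Φ.trans _).trans _) π)]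
  simp only [trans_apply, apply_symm_apply, numRightToLeftMinima_conj_rev,
    numLeftToRightMaxima_conj_rev, hmax, (hΦ π).1]
  exact and_comm
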